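/- Let $d\in\{2,3\}$, let $\Omega\subset\mathbb R^d$ be a bounded open set, let $\|\cdot\|$ and $(\cdot,\cdot)$ be the $L^2(\Omega)$ norm and inner product, and let $\mathbf X=H^1_0(\Omega;\mathbb R^d)$ be the closure of the compactly supported smooth vector fields on $\Omega$ in the $H^1$ norm. For $\mathbf g\in L^2(\Omega;\mathbb R^d)$ let $$\|\mathbf g\|_{-1}=\min\{c\ge 0:\ |(\mathbf g,\mathbf v)|\le c\,\|\nabla\mathbf v\|\ \ \forall\,\mathbf v\in\mathbf X\}$$ be its dual norm. Let $b^*(\mathbf u,\mathbf v,\mathbf w)=\tfrac12\big[((\mathbf u\cdot\nabla)\mathbf v,\mathbf w)-((\mathbf u\cdot\nabla)\mathbf w,\mathbf v)\big]$ for $\mathbf u,\mathbf v,\mathbf w\in\mathbf X$. Let $\pmb\varphi_1,\dots,\pmb\varphi_r\in\mathbf X$ be $L^2(\Omega)$-orthonormal (for instance a POD basis), and let $\mathbf X^r=\mathrm{span}\{\pmb\varphi_1,\dots,\pmb\varphi_r\}$. For $\delta>0$ and $\pmb\phi\in L^2(\Omega;\mathbb R^d)$ let $\overline{\pmb\phi}=F^r\pmb\phi\in\mathbf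 X^r$ be the ROM differential filter, i.e. the unique solution of $\delta^2(\nabla\overline{\pmb\phi},\nabla\mathbf v^r)+(\overline{\pmb\phi},\mathbf v^r)=(\pmb\phi,\mathbf v^r)$ for all $\mathbf v^r\in\mathbf X^r$. For an integer $N\ge 0$ let $D^r_N=\sum_{n=0}^N(I-F^r)^n$ be the van Cittert operator on $\mathbf X^r$. Let $\nu,\Delta t>0$, let $K\ge 1$ be an integer, $t_k=k\Delta t$, and $\mathbf f_k=\mathbf f(t_k)\in L^2(\Omega;\mathbb R^d)$. The BDF2 ADL-ROM scheme is: given $\mathbf u^r_0,\mathbf u^r_1\in\mathbf X^r$, for $k=1,\dots,K-1$ find $\mathbf u^r_{k+1}\in\mathbf X^r$ such that, for all $\mathbf v^r\in\mathbf X^r$, $$\frac{(3\mathbf u^r_{k+1}-4\mathbf u^r_k+\mathbf u^r_{k-1},\mathbf v^r)}{2\Delta t}+\nu(\nabla\mathbf u^r_{k+1},\nabla\mathbf v^r)+b^*\big(D^r_N\overline{\mathbf u^r_{k+1}},\mathbf u^r_{k+1},\mathbf v^r\big)=(\mathbf f_{k+1},\mathbf v^r).$$ **Lemma.** There is a smallest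 constant $C_\Omega\ge 0$ with $\|\mathbf v\|\le C_\Omega\|\nabla\mathbf v\|$ for all $\mathbf v\in\mathbf X$. Moreover, for all data as above, every step of the scheme has a solution whatever the two previous values in $\mathbf X^r$ are; in particular, for all $\mathbf u^r_0,\mathbf u^r_1\in\mathbf X^r$ the scheme has a solution $\mathbf u^r_k$ at each time step $k=2,\dots,K$. Every such solution satisfies $$\|\mathbf u^r_K\|^2+2\nu\Delta t\sum_{\kappa=1}^{K-1}\|\nabla\mathbf u^r_{\kappa+1}\|^2\ \le\ \|\mathbf u^r_1\|^2+\|2\mathbf u^r_1-\mathbf u^r_0\|^2+2\nu^{-1}\Delta t\sum_{\kappa=1}^{K-1}\|\mathbf f_{\kappa+1}\|_{-1}^2\ \le\ \|\mathbf u^r_1\|^2+\|2\mathbf u^r_1-\mathbf u^r_0\|^2+2\nu^{-1}\Delta t\sum_{\kappa=1}^{K-1}C_\Omega^2\,\|\mathbf f_{\kappa+1}\|^2 .$$ -/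

import Mathlib

open MeasureTheory
open scoped ContDiff

namespace ADLROM

noncomputable section

/-- Physical space `ℝ^d` with its Euclidean norm. -/
abbrev Space (d : ℕ) := EuclideanSpace ℝ (Fin d)

/-- `d × d` real matrices with the Frobenius norm and inner product. -/
abbrev Mat (d : ℕ) := EuclideanSpace ℝ (Fin d × Fin d)

/-- `L²(Ω; ℝ^d)`. -/
abbrev L2Vec {d : ℕ} (Ω : Set (Space d)) := Lp (Space d) 2 (volume.restrict Ω)

/-- `L²(Ω; ℝ^{d×d})`. -/
abbrev L2Mat {d : ℕ} (Ω : Set (Space d)) := Lp (Mat d) 2 (volume.restrict Ω)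

/-- Smooth vector fields with compact support contained in `Ω`. -/
def IsTestField {d : ℕ} (Ω : Set (Space d)) (ψ : Space d → Space d) : Prop :=
  ContDiff ℝ ∞ ψ ∧ HasCompactSupport ψ ∧ tsupport ψ ⊆ Ω

/-- The classical gradient of a vector field: entry `(i, j)` is `∂_j ψ_i`. -/
def gradField {d : ℕ} (ψ : Space d → Space d) (x : Space d) : Mat d :=
  WithLp.toLp 2 fun ij : Fin d × Fin d => fderiv ℝ ψ x (EuclideanSpace.single ij.2 1) ij.1

/-- The space `X = H¹₀(Ω; ℝ^d)`: the closure of the test fields in the `H¹` norm. An element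
is stored as the pair `(u, ∇u)`, so the closure is that of the pairs `(ψ, ∇ψ)` in the Hilbert
sum `L² ⊕ L²`, whose norm restricts to the `H¹` norm `(‖u‖² + ‖∇u‖²)^{1/2}`. The second component is the weak gradient of the first
(`hasWeakGradient_of_mem_H10`) and, for open `Ω`, is determined by it (`toL2_injective`). -/
def H10 {d : ℕ} (Ω : Set (Space d)) : Submodule ℝ (WithLp 2 (L2Vec Ω × L2Mat Ω)) :=
  (Submodule.span ℝ
    {p : WithLp 2 (L2Vec Ω × L2Mat Ω) | ∃ ψ : Space d → Space d, IsTestField Ω ψ ∧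
      p.fst =ᵐ[volume.restrict Ω] ψ ∧ p.snd =ᵐ[volume.restrict Ω] gradField ψ}).topologicalClosure

/-- The function in `L²(Ω; ℝ^d)` underlying an element of `H¹₀(Ω; ℝ^d)`. -/
def toL2 {d : ℕ} {Ω : Set (Space d)} : H10 Ω →ₗ[ℝ] L2Vec Ω :=
  (WithLp.fstₗ 2 ℝ (L2Vec Ω) (L2Mat Ω)).comp (H10 Ω).subtype

/-- The gradient `∇u ∈ L²(Ω; ℝ^{d×d})` of an element of `H¹₀(Ω; ℝ^d)`. -/
def grad {d : ℕ} {Ω : Set (Space d)} : H10 Ω →ₗ[ℝ] L2Mat Ω :=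
  (WithLp.sndₗ 2 ℝ (L2Vec Ω) (L2Mat Ω)).comp (H10 Ω).subtype

/-- `G` is the weak gradient of `u` on `Ω`: `∫_Ω u_i ∂_j η = - ∫_Ω G_ij η` for all scalar
test functions `η`. -/
def HasWeakGradient {d : ℕ} {Ω : Set (Space d)} (u : L2Vec Ω) (G : L2Mat Ω) : Prop :=
  ∀ η : Space d → ℝ, ContDiff ℝ ∞ η → HasCompactSupport η → tsupport η ⊆ Ω →
    ∀ i j : Fin d,
      ∫ x in Ω, u x i * fderiv ℝ η x (EuclideanSpace.single j 1) = - ∫ x in Ω, G x (i, j) * η x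

/-- `((u · ∇) v, w) = ∫_Ω ∑_{i,j} u_j (∂_j v_i) w_i`. -/
def convection {d : ℕ} {Ω : Set (Space d)} (u v w : H10 Ω) : ℝ :=
  ∫ x in Ω, ∑ i : Fin d, ∑ j : Fin d, toL2 u x j * grad v x (i, j) * toL2 w x i

/-- The skew-symmetric trilinear form `b*`. -/
def bStar {d : ℕ} {Ω : Set (Space d)} (u v w : H10 Ω) : ℝ :=
  (1 / 2) * (convection u v w - convection u w v)

/-- The reduced space `X^r = span {φ_1, …, φ_r}`. -/
def romSpace {d r : ℕ} {Ω : Set (Space d)} (φ : Fin r → H10 Ω) : Submodule ℝ (H10 Ω) :=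
  Submodule.span ℝ (Set.range φ)

/-- `F` is the reduced order differential filter of radius `δ`: for every `w ∈ L²(Ω; ℝ^d)`, `F w`
is an element of `X^r` with `δ² (∇ F w, ∇ v) + (F w, v) = (w, v)` for all `v ∈ X^r`. -/
def IsRomFilter {d r : ℕ} {Ω : Set (Space d)} (φ : Fin r → H10 Ω) (δ : ℝ)
    (F : L2Vec Ω →ₗ[ℝ] romSpace φ) : Prop :=
  ∀ (w : L2Vec Ω) (v : romSpace φ),
    δ ^ 2 * inner ℝ (grad (F w : H10 Ω)) (grad (v : H10 Ω))
      + inner ℝ (toL2 (F w : H10 Ω)) (toL2 (v : H10 Ω)) = inner ℝ w (toL2 (v : H10 Ω))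

open Classical in
/-- The reduced order differential filter `F^r : L²(Ω; ℝ^d) → X^r` of radius `δ`. It exists and is
unique when `δ > 0` (`existsUnique_isRomFilter`). -/
def romFilter {d r : ℕ} {Ω : Set (Space d)} (φ : Fin r → H10 Ω) (δ : ℝ) :
    L2Vec Ω →ₗ[ℝ] romSpace φ :=
  if h : ∃ F, IsRomFilter φ δ F then h.choose else 0

/-- The filter as an operator on `X^r`. -/
def romFilterEnd {d r : ℕ} {Ω : Set (Space d)} (φ : Fin r → H10 Ω) (δ : ℝ) :
    Module.End ℝ (romSpace φ) :=
  (romFilter φ δ).comp (toL2.comp (romSpace φ).subtype)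

/-- The van Cittert approximate deconvolution operator `D_N^r = ∑_{n=0}^N (I - F^r)^n`, on the
space `X^r` in which the filtered functions lie. -/
def romDeconv {d r : ℕ} {Ω : Set (Space d)} (φ : Fin r → H10 Ω) (δ : ℝ) (N : ℕ) :
    Module.End ℝ (romSpace φ) :=
  ∑ n ∈ Finset.range (N + 1), (1 - romFilterEnd φ δ) ^ n

/-- One step of the BDF2 ADL-ROM scheme: given `uold = u_{k-1}`, `u = u_k` and `f = f_{k+1}`, the
element `unew` of `X^r` is admissible as `u_{k+1}`. -/
def IsADLStep {d r : ℕ} {Ω : Set (Space d)} (φ : Fin r → H10 Ω) (ν Δt δ : ℝ) (N : ℕ)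
    (f : L2Vec Ω) (uold u unew : romSpace φ) : Prop :=
  ∀ v : romSpace φ,
    inner ℝ (toL2 ((3 : ℝ) • unew - (4 : ℝ) • u + uold : romSpace φ).1) (toL2 v.1) / (2 * Δt)
      + ν * inner ℝ (grad unew.1) (grad v.1)
      + bStar (romDeconv φ δ N (romFilter φ δ (toL2 unew.1))).1 unew.1 v.1
      = inner ℝ f (toL2 v.1)

/-- `u_0, …, u_K` is a run of the BDF2 ADL-ROM scheme with initial values `a = u_0`, `b = u_1`,
at the times `t_k = k Δt`. The values of `u` beyond `K` are irrelevant. -/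
def IsADLSolution {d r : ℕ} {Ω : Set (Space d)} (φ : Fin r → H10 Ω) (ν Δt δ : ℝ) (N K : ℕ)
    (f : ℝ → L2Vec Ω) (a b : romSpace φ) (u : ℕ → romSpace φ) : Prop :=
  u 0 = a ∧ u 1 = b ∧ ∀ k ∈ Finset.Icc 1 (K - 1),
    IsADLStep φ ν Δt δ N (f (((k : ℝ) + 1) * Δt)) (u (k - 1)) (u k) (u (k + 1))

/-- The dual norm `‖f‖_{-1} = sup_{0 ≠ v ∈ X} (f, v) / ‖∇v‖` of `f ∈ L²(Ω; ℝ^d)`, as the smallest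
`c ≥ 0` with `|(f, v)| ≤ c ‖∇v‖` for all `v ∈ X`. Such `c` exist as soon as the Poincaré inequality
holds on `Ω`, e.g. for bounded `Ω`. -/
def dualNorm {d : ℕ} {Ω : Set (Space d)} (f : L2Vec Ω) : ℝ :=
  sInf {c : ℝ | 0 ≤ c ∧ ∀ v : H10 Ω, |inner ℝ f (toL2 v)| ≤ c * ‖grad v‖}

/-- The constants `c ≥ 0` for which the Poincaré inequality `‖v‖ ≤ c ‖∇v‖` holds on `X`. -/
def poincareConstants {d : ℕ} (Ω : Set (Space d)) : Set ℝ :=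
  {c : ℝ | 0 ≤ c ∧ ∀ v : H10 Ω, ‖toL2 v‖ ≤ c * ‖grad v‖}

instance finiteDimensional_romSpace {d r : ℕ} {Ω : Set (Space d)} (φ : Fin r → H10 Ω) :
    FiniteDimensional ℝ (romSpace φ) :=
  FiniteDimensional.span_of_finite ℝ (Set.finite_range φ)

theorem existsUnique_riesz {V H₁ H₂ : Type*} [AddCommGroup V] [Module ℝ V] [FiniteDimensional ℝ V]
    [NormedAddCommGroup H₁] [InnerProductSpace ℝ H₁] [NormedAddCommGroup H₂]
    [InnerProductSpace ℝ H₂] (S : V →ₗ[ℝ] H₁) (T : V →ₗ[ℝ] H₂)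
    (hST : ∀ v, S v = 0 → T v = 0 → v = 0) {δ : ℝ} (hδ : 0 < δ) :
    ∃! F : H₁ →ₗ[ℝ] V, ∀ (w : H₁) (v : V),
      δ ^ 2 * inner ℝ (T (F w)) (T v) + inner ℝ (S (F w)) (S v) = inner ℝ w (S v) := by
  let A : V →ₗ[ℝ] Module.Dual ℝ V :=
    LinearMap.mk₂ ℝ (fun u v => δ ^ 2 * inner ℝ (T u) (T v) + inner ℝ (S u) (S v))
      (by intro a b c; simp only [map_add, inner_add_left]; ring)
      (by intro a b c; simp only [map_smul, real_inner_smul_left, smul_eq_mul]; ring)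
      (by intro a b c; simp only [map_add, inner_add_right]; ring)
      (by intro a b c; simp only [map_smul, real_inner_smul_right, smul_eq_mul]; ring)
  have hA : ∀ u v, A u v = δ ^ 2 * inner ℝ (T u) (T v) + inner ℝ (S u) (S v) := fun u v => rfl
  have hinj : Function.Injective A := by
    rw [injective_iff_map_eq_zero]
    intro u hu
    have h0 : A u u = 0 := by rw [hu]; rfl
    rw [hA, real_inner_self_eq_norm_sq, real_inner_self_eq_norm_sq] at h0
    have hδ2 : 0 < δ ^ 2 := by positivity
    have hT : δ ^ 2 * ‖T u‖ ^ 2 = 0 := by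
      have := mul_nonneg hδ2.le (sq_nonneg ‖T u‖)
      nlinarith [sq_nonneg ‖S u‖]
    have hS : ‖S u‖ ^ 2 = 0 := by linarith
    apply hST u
    · simpa using hS
    · simpa [hδ.ne'] using hT
  let e := LinearEquiv.ofInjectiveOfFinrankEq A hinj Subspace.dual_finrank_eq.symm
  let B : H₁ →ₗ[ℝ] Module.Dual ℝ V :=
    LinearMap.mk₂ ℝ (fun w v => inner ℝ w (S v))
      (by intro a b c; simp only [inner_add_left])
      (by intro a b c; simp only [real_inner_smul_left, smul_eq_mul])
      (by intro a b c; simp only [map_add, inner_add_right])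
      (by intro a b c; simp only [map_smul, real_inner_smul_right, smul_eq_mul])
  refine ⟨e.symm.toLinearMap.comp B, ?_, ?_⟩
  · intro w v
    have h : A (e.symm (B w)) = B w := e.apply_symm_apply (B w)
    exact (hA (e.symm (B w)) v).symm.trans (LinearMap.congr_fun h v)
  · intro F hF
    apply LinearMap.ext
    intro w
    apply hinj
    have h : A (e.symm (B w)) = B w := e.apply_symm_apply (B w)
    refine Eq.trans ?_ h.symm
    apply LinearMap.ext
    intro v
    exact hF w v

/-- The filter is well defined. -/
theorem existsUnique_isRomFilter {d r : ℕ} {Ω : Set (Space d)} (φ : Fin r → H10 Ω) {δ : ℝ}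
    (hδ : 0 < δ) : ∃! F, IsRomFilter φ δ F :=
  existsUnique_riesz (toL2.comp (romSpace φ).subtype) (grad.comp (romSpace φ).subtype)
    (fun _ h₁ h₂ => Subtype.ext (Subtype.ext (WithLp.ofLp_injective 2 (Prod.ext h₁ h₂)))) hδ

theorem romFilter_spec {d r : ℕ} {Ω : Set (Space d)} (φ : Fin r → H10 Ω) {δ : ℝ}
    (hδ : 0 < δ) : IsRomFilter φ δ (romFilter φ δ) := by
  have h : ∃ F, IsRomFilter φ δ F := (existsUnique_isRomFilter φ hδ).exists
  rw [romFilter, dif_pos h]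
  exact h.choose_spec

theorem memLp_single {d : ℕ} {ι : Type*} [Fintype ι] [DecidableEq ι] (Ω : Set (Space d)) (i : ι)
    {g : Space d → ℝ} (hg : Continuous g) (hc : HasCompactSupport g) :
    MemLp (fun x => EuclideanSpace.single i (g x)) 2 (volume.restrict Ω) := by
  apply Continuous.memLp_of_hasCompactSupport
  · exact (PiLp.continuous_toLp 2 _).comp ((continuous_single i).comp hg)
  · exact hc.comp_left (g := fun t : ℝ => EuclideanSpace.single i t) (by simp)

theorem inner_toLp_single {d : ℕ} {ι : Type*} [Fintype ι] [DecidableEq ι] {Ω : Set (Space d)}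
    (i : ι) {g : Space d → ℝ} (hg : Continuous g) (hc : HasCompactSupport g)
    (u : Lp (EuclideanSpace ℝ ι) 2 (volume.restrict Ω)) :
    inner ℝ ((memLp_single Ω i hg hc).toLp _) u = ∫ x in Ω, u x i * g x := by
  rw [L2.inner_def]
  apply integral_congr_ae
  filter_upwards [(memLp_single Ω i hg hc).coeFn_toLp] with x hx
  rw [hx]
  simp [EuclideanSpace.inner_single_left, mul_comm]

theorem hasWeakGradient_of_mem_H10 {d : ℕ} {Ω : Set (Space d)} (u : H10 Ω) :
    HasWeakGradient (toL2 u) (grad u) := by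
  intro η hη hc hs i j
  have hη1 : Continuous (fun x => fderiv ℝ η x (EuclideanSpace.single j 1)) :=
    (hη.continuous_fderiv (by simp)).clm_apply continuous_const
  have hc1 : HasCompactSupport (fun x => fderiv ℝ η x (EuclideanSpace.single j 1)) :=
    hc.fderiv_apply ℝ _
  let a := (memLp_single Ω i hη1 hc1).toLp _
  let b := (memLp_single Ω (i, j) hη.continuous hc).toLp _
  let L : WithLp 2 (L2Vec Ω × L2Mat Ω) →L[ℝ] ℝ :=
    (innerSL ℝ a).comp (WithLp.fstL 2 ℝ _ _) + (innerSL ℝ b).comp (WithLp.sndL 2 ℝ _ _)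
  have hL : ∀ p, L p = (∫ x in Ω, p.fst x i * fderiv ℝ η x (EuclideanSpace.single j 1))
      + ∫ x in Ω, p.snd x (i, j) * η x := by
    intro p
    rw [← inner_toLp_single i hη1 hc1, ← inner_toLp_single (i, j) hη.continuous hc]
    rfl
  have hle : H10 Ω ≤ LinearMap.ker (L : WithLp 2 (L2Vec Ω × L2Mat Ω) →ₗ[ℝ] ℝ) := by
    refine Submodule.topologicalClosure_minimal _ (Submodule.span_le.2 ?_) L.isClosed_ker
    rintro p ⟨ψ, ⟨hψ, hψc, hψs⟩, h1, h2⟩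
    change L p = 0
    rw [hL]
    have hi : ∀ x v, fderiv ℝ (fun y => ψ y i) x v = fderiv ℝ ψ x v i := by
      intro x v
      have hd : DifferentiableAt ℝ ψ x := (hψ.differentiable (by simp)).differentiableAt
      have := ((EuclideanSpace.proj (𝕜 := ℝ) i).hasFDerivAt.comp x hd.hasFDerivAt).fderiv
      exact congrArg (fun T => T v) this
    have hψi : ContDiff ℝ ∞ (fun y => ψ y i) :=
      (EuclideanSpace.proj (𝕜 := ℝ) i).contDiff.comp hψ
    have hψic : HasCompactSupport (fun y => ψ y i) :=
      hψc.comp_left (g := fun z : Space d => z i) (by simp)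
    have hψ1 : Continuous (fun x => fderiv ℝ (fun y => ψ y i) x (EuclideanSpace.single j 1)) :=
      (hψi.continuous_fderiv (by simp)).clm_apply continuous_const
    have e1 : (∫ x in Ω, p.fst x i * fderiv ℝ η x (EuclideanSpace.single j 1))
        = ∫ x, ψ x i * fderiv ℝ η x (EuclideanSpace.single j 1) := by
      refine Eq.trans ?_ (setIntegral_eq_integral_of_forall_compl_eq_zero (s := Ω) ?_)
      · apply integral_congr_ae
        filter_upwards [h1] with x hx
        rw [hx]
      · intro x hx
        have : ψ x = 0 := image_eq_zero_of_notMem_tsupport fun h => hx (hψs h)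
        simp [this]
    have e2 : (∫ x in Ω, p.snd x (i, j) * η x)
        = ∫ x, fderiv ℝ (fun y => ψ y i) x (EuclideanSpace.single j 1) * η x := by
      refine Eq.trans ?_ (setIntegral_eq_integral_of_forall_compl_eq_zero (s := Ω) ?_)
      · apply integral_congr_ae
        filter_upwards [h2] with x hx
        rw [hx, hi]
        rfl
      · intro x hx
        have : η x = 0 := image_eq_zero_of_notMem_tsupport fun h => hx (hs h)
        simp [this]
    rw [e1, e2, integral_mul_fderiv_eq_neg_fderiv_mul_of_integrable]
    · ring
    · exact (hψ1.mul hη.continuous).integrable_of_hasCompactSupport hc.mul_left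
    · exact (hψi.continuous.mul hη1).integrable_of_hasCompactSupport hc1.mul_left
    · exact (hψi.continuous.mul hη.continuous).integrable_of_hasCompactSupport hc.mul_left
    · exact fun x _ => (hψi.differentiable (by simp)).differentiableAt
    · exact fun x _ => (hη.differentiable (by simp)).differentiableAt
  have h0 : L u.1 = 0 := hle u.2
  rw [hL] at h0
  exact eq_neg_of_add_eq_zero_left h0

theorem toL2_injective {d : ℕ} {Ω : Set (Space d)} (hΩ : IsOpen Ω) :
    Function.Injective (toL2 : H10 Ω → L2Vec Ω) := by
  rw [injective_iff_map_eq_zero]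
  intro u hu
  have hG : grad u = 0 := by
    have key : ∀ ij : Fin d × Fin d, ∀ᵐ x ∂(volume.restrict Ω), grad u x ij = 0 := by
      rintro ⟨i, j⟩
      have hloc : LocallyIntegrable (fun x => grad u x (i, j)) (volume.restrict Ω) :=
        MemLp.locallyIntegrable
          ((EuclideanSpace.proj (𝕜 := ℝ) (i, j)).comp_memLp (grad u)) (by norm_num)
      have h := hΩ.ae_eq_zero_of_integral_contDiff_smul_eq_zero (μ := volume.restrict Ω)
        (hloc.locallyIntegrableOn Ω) (fun g hg hgc hgs => by
          have h1 := hasWeakGradient_of_mem_H10 u g hg hgc hgs i j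
          have h2 : ∫ x in Ω, toL2 u x i * fderiv ℝ g x (EuclideanSpace.single j 1) = 0 := by
            rw [hu]
            apply integral_eq_zero_of_ae
            filter_upwards [Lp.coeFn_zero (Space d) 2 (volume.restrict Ω)] with x hx
            rw [hx]
            simp
          rw [h2] at h1
          simpa [mul_comm] using h1.symm)
      filter_upwards [h, ae_restrict_mem hΩ.measurableSet] with x hx hxΩ using hx hxΩ
    apply Lp.ext
    filter_upwards [ae_all_iff.2 key, Lp.coeFn_zero (Mat d) 2 (volume.restrict Ω)] with x hx hz
    rw [hz]
    ext ij
    exact hx ij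
  exact Subtype.ext (WithLp.ofLp_injective 2 (Prod.ext hu hG))

end

end ADLROM

open ADLROM

/-! The bound is the energy estimate of BDF2. Testing a step with its own solution kills the
convection term, since `bStar` is skew in its last two arguments. The identity `bdf2_identity` turns
the time difference into increments of `‖u_k‖² + ‖2u_k - u_{k-1}‖²` plus a nonnegative square.
Young's inequality absorbs half of the viscous term, and summation over the steps telescopes. The
second inequality is `‖f‖_{-1} ≤ C_Ω ‖f‖`, by Cauchy-Schwarz and Poincaré.

Existence of a step is a quadratic system in finite dimension, `exists_solution_of_coercive`: by the
same skew-symmetry the residual field points outwards on large spheres, so it has a zero. This rests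
on the no-retraction theorem, proved analytically. If `f` were a `C¹` retraction onto the sphere and
`h = f - id`, then `∫_B det(1 + t Dh)` is a polynomial in `t`. For small `t > 0` it equals the
volume of `B`, because `id + t h` maps `B` bijectively onto itself; at `t = 1` it is zero, because
`Df` is singular everywhere.

The nonlinear term is trilinear only if its integrals converge. The `L⁴` Sobolev bound on `H10 Ω`
ensures this for `d = 2, 3`, and its `L²` version is the Poincaré inequality. Both are proved for
test fields and pass to the closure by Fatou. -/

/-- Extrapolation of polynomials of degree at most `n` to `1` from nodes close to `0`. -/
theorem Polynomial.exists_extrapolation_weights (n : ℕ) {ε : ℝ} (hε : 0 < ε) :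
    ∃ c t : Fin (n + 1) → ℝ, (∀ i, 0 < t i ∧ t i < ε) ∧ ∑ i, c i = 1 ∧
      ∀ p : Polynomial ℝ, p.natDegree ≤ n → p.eval 1 = ∑ i, c i * p.eval (t i) := by
  -- The shift by `2` puts even the largest node, `ε / 2`, strictly below `ε`.
  let t : Fin (n + 1) → ℝ := fun i => ε / (i + 2)
  have ht : Set.InjOn t (Finset.univ : Finset (Fin (n + 1))) := by
    intro i _ j _ hij
    have h1 : (0 : ℝ) < i + 2 := by positivity
    have h2 : (0 : ℝ) < j + 2 := by positivity
    have : ε / ((i : ℝ) + 2) = ε / ((j : ℝ) + 2) := hij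
    rw [div_eq_div_iff h1.ne' h2.ne'] at this
    have h3 := mul_left_cancel₀ hε.ne' this
    ext
    have h4 : ((i : ℕ) : ℝ) = (j : ℕ) := by linarith
    exact_mod_cast h4
  have key : ∀ p : Polynomial ℝ, p.natDegree ≤ n →
      p.eval 1 = ∑ i, (Lagrange.basis Finset.univ t i).eval 1 * p.eval (t i) := by
    intro p hp
    have hdeg : p.degree < (Finset.univ : Finset (Fin (n + 1))).card := by
      rw [Finset.card_univ, Fintype.card_fin]
      refine lt_of_le_of_lt Polynomial.degree_le_natDegree ?_
      exact_mod_cast Nat.lt_succ_of_le hp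
    conv_lhs => rw [Lagrange.eq_interpolate ht hdeg]
    rw [Lagrange.interpolate_apply, Polynomial.eval_finsetSum]
    refine Finset.sum_congr rfl fun i _ => ?_
    rw [Polynomial.eval_mul, Polynomial.eval_C, mul_comm]
  refine ⟨fun i => (Lagrange.basis Finset.univ t i).eval 1, t, fun i => ⟨by positivity, ?_⟩, ?_,
    key⟩
  · have h1 : (1 : ℝ) < i + 2 := by
      have : (0 : ℝ) ≤ ((i : ℕ) : ℝ) := by positivity
      linarith
    exact div_lt_self hε h1
  · have := key 1 (by simp)
    simpa using this.symm

/-! ### Determinants of perturbations of the identity -/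

section Det

variable {E : Type*} [NormedAddCommGroup E] [NormedSpace ℝ E] [FiniteDimensional ℝ E]

theorem ContinuousLinearMap.exists_polynomial_det_one_add_smul (A : E →L[ℝ] E) :
    ∃ p : Polynomial ℝ, p.natDegree ≤ Module.finrank ℝ E ∧
      ∀ t : ℝ, (1 + t • A).det = p.eval t := by
  let b := Module.finBasis ℝ E
  let M := LinearMap.toMatrix b b (A : E →ₗ[ℝ] E)
  refine ⟨Matrix.det ((Polynomial.X : Polynomial ℝ) • M.map Polynomial.C
    + (1 : Matrix _ _ ℝ).map Polynomial.C), ?_, fun t => ?_⟩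
  · simpa using Polynomial.natDegree_det_X_add_C_le M 1
  · have h1 : (1 + t • A).det = LinearMap.det ((1 : E →ₗ[ℝ] E) + t • (A : E →ₗ[ℝ] E)) := rfl
    rw [h1, ← LinearMap.det_toMatrix b, ← Polynomial.coe_evalRingHom, RingHom.map_det]
    congr 1
    ext i j
    simp only [map_add, LinearMap.toMatrix_one, map_smul, Matrix.add_apply, Matrix.smul_apply,
      smul_eq_mul, Matrix.one_apply, M, RingHom.mapMatrix_apply, Matrix.map_apply,
      Polynomial.coe_evalRingHom, Polynomial.eval_mul, Polynomial.eval_X,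
      Polynomial.eval_C]
    rw [add_comm]

/-- A kernel vector of `1 + s • A` with `0 ≤ s ≤ 1` would satisfy `‖x‖ ≤ ‖A‖ ‖x‖`. Hence the
determinant has no zero on the segment from `1` to `1 + A` and keeps the sign it has at `1`. This
removes the absolute value from the change of variables formula. -/
theorem ContinuousLinearMap.det_one_add_pos {A : E →L[ℝ] E} (hA : ‖A‖ < 1) :
    0 < (1 + A).det := by
  obtain ⟨p, -, hp⟩ := A.exists_polynomial_det_one_add_smul
  have hne : ∀ s ∈ Set.Icc (0 : ℝ) 1, (1 + s • A).det ≠ 0 := by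
    intro s hs h0
    have h1 : LinearMap.det ((1 + s • A : E →L[ℝ] E) : E →ₗ[ℝ] E) = 0 := h0
    obtain ⟨x, hx, hx0⟩ := Submodule.exists_mem_ne_zero_of_ne_bot
      (LinearMap.bot_lt_ker_of_det_eq_zero h1).ne'
    have h2 : x + s • A x = 0 := hx
    have h3 : ‖x‖ ≤ ‖A‖ * ‖x‖ := by
      calc ‖x‖ = ‖s • A x‖ := (congrArg norm (eq_neg_of_add_eq_zero_left h2)).trans (norm_neg _)
        _ = s * ‖A x‖ := by rw [norm_smul, Real.norm_of_nonneg hs.1]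
        _ ≤ 1 * ‖A x‖ := by gcongr; exact hs.2
        _ ≤ ‖A‖ * ‖x‖ := by rw [one_mul]; exact A.le_opNorm x
    have h4 : 0 < ‖x‖ := norm_pos_iff.2 hx0
    nlinarith
  by_contra hcon
  have hcont : ContinuousOn (fun s : ℝ => (1 + s • A).det) (Set.Icc 0 1) := by
    simp_rw [hp]
    exact p.continuous.continuousOn
  have := intermediate_value_Icc' zero_le_one hcont
  have h0 : (0 : ℝ) ∈ Set.Icc (1 + (1 : ℝ) • A).det (1 + (0 : ℝ) • A).det := by
    refine ⟨by simpa using not_lt.1 hcon, ?_⟩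
    have : (1 : E →L[ℝ] E).det = 1 := LinearMap.det_id
    simp [this]
  obtain ⟨s, hs, hs0⟩ := this h0
  exact hne s hs hs0

end Det

/-! ### No-retraction theorem, zeros of vector fields, solvability of coercive quadratic systems -/

section NoRetraction

variable {E : Type*} [NormedAddCommGroup E] [InnerProductSpace ℝ E] [FiniteDimensional ℝ E]

/-- Differentiating `‖f‖² = 1` shows that the range of the derivative is orthogonal to `f x ≠ 0`, so
the derivative is not surjective. -/
theorem det_fderiv_eq_zero_of_norm_eq_one {f : E → E} (hf : ContDiff ℝ 1 f)
    (hf1 : ∀ x, ‖f x‖ = 1) (x : E) : (fderiv ℝ f x).det = 0 := by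
  have hd : HasFDerivAt f (fderiv ℝ f x) x :=
    (hf.differentiable one_ne_zero).differentiableAt.hasFDerivAt
  have hort : ∀ v, inner ℝ (f x) (fderiv ℝ f x v) = 0 := by
    intro v
    have h1 := hd.norm_sq
    have h2 : (fun y => ‖f y‖ ^ 2) = fun _ => (1 : ℝ) := by funext y; simp [hf1]
    rw [h2] at h1
    have h3 := congrArg (fun T => T v) (h1.unique (hasFDerivAt_const (1 : ℝ) x))
    simpa using h3
  by_contra hdet
  have hsurj : Function.Surjective (fderiv ℝ f x) := by
    have hu : IsUnit (LinearMap.det (fderiv ℝ f x : E →ₗ[ℝ] E)) := isUnit_iff_ne_zero.2 hdet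
    exact (LinearEquiv.ofIsUnitDet (f := (fderiv ℝ f x : E →ₗ[ℝ] E))
      (v := Module.finBasis ℝ E) (v' := Module.finBasis ℝ E)
      (by rw [LinearMap.det_toMatrix]; exact hu)).surjective
  obtain ⟨v, hv⟩ := hsurj (f x)
  have := hort v
  rw [hv, real_inner_self_eq_norm_sq, hf1] at this
  norm_num at this

/-- The homotopy `(1 - t) x + t f x` maps the closed unit ball bijectively onto itself for
small `t`. -/
theorem image_closedBall_eq_of_small {h : E → E} {M t : ℝ} (ht : 0 < t) (htM : t * M < 1)
    (ht3 : t * 3 < 1)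
    (hlip : ∀ x ∈ Metric.closedBall (0 : E) 2, ∀ y ∈ Metric.closedBall (0 : E) 2,
      ‖h x - h y‖ ≤ M * ‖x - y‖)
    (hf1 : ∀ x, ‖x + h x‖ = 1) (hs : ∀ x, 1 ≤ ‖x‖ → x + h x = ‖x‖⁻¹ • x) (hM : 0 ≤ M) :
    Set.InjOn (fun x => x + t • h x) (Metric.closedBall 0 1) ∧
      (fun x => x + t • h x) '' Metric.closedBall 0 1 = Metric.closedBall 0 1 := by
  have hsub : Metric.closedBall (0 : E) 1 ⊆ Metric.closedBall 0 2 :=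
    Metric.closedBall_subset_closedBall (by norm_num)
  have hconv : ∀ x, x + t • h x = (1 - t) • x + t • (x + h x) := by intro x; module
  refine ⟨?_, Set.Subset.antisymm ?_ ?_⟩
  · intro x hx y hy hxy
    have h1 : x - y = -(t • (h x - h y)) := by
      have h0 : x + t • h x = y + t • h y := hxy
      rw [smul_sub, neg_sub, sub_eq_sub_iff_add_eq_add, h0]
      abel
    have h2 : ‖x - y‖ ≤ t * (M * ‖x - y‖) := by
      conv_lhs => rw [h1, norm_neg, norm_smul, Real.norm_of_nonneg ht.le]
      exact mul_le_mul_of_nonneg_left (hlip x (hsub hx) y (hsub hy)) ht.le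
    have h3 : ‖x - y‖ = 0 := by
      by_contra hne
      have : 0 < ‖x - y‖ := lt_of_le_of_ne (norm_nonneg _) (Ne.symm hne)
      nlinarith
    exact sub_eq_zero.1 (norm_eq_zero.1 h3)
  · rintro _ ⟨x, hx, rfl⟩
    rw [mem_closedBall_zero_iff] at hx ⊢
    simp only [hconv]
    calc ‖(1 - t) • x + t • (x + h x)‖ ≤ ‖(1 - t) • x‖ + ‖t • (x + h x)‖ := norm_add_le _ _
      _ = (1 - t) * ‖x‖ + t * 1 := by
        rw [norm_smul, norm_smul, Real.norm_of_nonneg ht.le,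
          Real.norm_of_nonneg (by linarith : 0 ≤ 1 - t), hf1]
      _ ≤ 1 := by nlinarith
  · intro y hy
    rw [mem_closedBall_zero_iff] at hy
    -- A preimage of `y` is a fixed point of `x ↦ y - t • h x`. On the ball of radius `2`, `‖h x‖ ≤
    -- 1 + 2`, so `t * 3 < 1` keeps the map inside that ball and `t * M < 1` makes it a contraction.
    have hmaps : Set.MapsTo (fun x => y - t • h x) (Metric.closedBall 0 2)
        (Metric.closedBall 0 2) := by
      intro x hx
      rw [mem_closedBall_zero_iff] at hx ⊢
      have h1 : ‖h x‖ ≤ 3 := by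
        have : h x = (x + h x) - x := by abel
        rw [this]
        refine (norm_sub_le _ _).trans ?_
        rw [hf1]
        linarith
      calc ‖y - t • h x‖ ≤ ‖y‖ + ‖t • h x‖ := norm_sub_le _ _
        _ = ‖y‖ + t * ‖h x‖ := by rw [norm_smul, Real.norm_of_nonneg ht.le]
        _ ≤ 2 := by nlinarith
    have hcontr : ContractingWith (t * M).toNNReal
        (hmaps.restrict (fun x => y - t • h x) _ _) := by
      refine ⟨by rw [← NNReal.coe_lt_coe, Real.coe_toNNReal _ (by positivity)]; exact htM, ?_⟩
      refine LipschitzWith.of_dist_le_mul fun a b => ?_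
      rw [Real.coe_toNNReal _ (by positivity)]
      change dist (y - t • h a) (y - t • h b) ≤ t * M * dist (a : E) b
      rw [dist_sub_left, dist_smul₀, Real.norm_of_nonneg ht.le, mul_assoc, dist_eq_norm,
        dist_eq_norm]
      exact mul_le_mul_of_nonneg_left (hlip a a.2 b b.2) ht.le
    obtain ⟨x, -, hx, -⟩ := hcontr.exists_fixedPoint' (x := 0)
      (Metric.isClosed_closedBall.isComplete) hmaps (by simp) (edist_ne_top _ _)
    have hx' : x + t • h x = y := by
      have h0 : y - t • h x = x := hx
      exact (sub_eq_iff_eq_add.1 h0).symm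
    refine ⟨x, ?_, hx'⟩
    rw [mem_closedBall_zero_iff]
    -- Outside the unit ball the homotopy is radial and has norm `(1 - t) ‖x‖ + t > 1`, so it cannot
    -- hit `y`.
    by_contra hcon
    have hx1 : 1 < ‖x‖ := not_le.1 hcon
    have h4 : y = ((1 - t) + t * ‖x‖⁻¹) • x := by
      rw [← hx', hconv, hs x hx1.le, smul_smul, add_smul]
    have h5 : ‖y‖ = (1 - t) * ‖x‖ + t := by
      rw [h4, norm_smul, Real.norm_of_nonneg]
      · have : ‖x‖ ≠ 0 := by positivity
        field_simp
      · have : 0 ≤ t * ‖x‖⁻¹ := by positivity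
        linarith
    nlinarith

/-- There is no `C¹` retraction of a Euclidean space onto its unit sphere. -/
theorem no_smooth_retraction {f : E → E} (hf : ContDiff ℝ 1 f) (hf1 : ∀ x, ‖f x‖ = 1)
    (hs : ∀ x, 1 ≤ ‖x‖ → f x = ‖x‖⁻¹ • x) : False := by
  let _ : MeasurableSpace E := borel E
  have _ : BorelSpace E := ⟨rfl⟩
  set B : Set E := Metric.closedBall 0 1 with hB
  let h : E → E := fun x => f x - x
  have hfh : ∀ x, x + h x = f x := fun x => by simp [h]
  have hh : ContDiff ℝ 1 h := hf.sub contDiff_id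
  have hhd : ∀ x, HasFDerivAt h (fderiv ℝ h x) x := fun x =>
    (hh.differentiable one_ne_zero).differentiableAt.hasFDerivAt
  have hcont : Continuous (fderiv ℝ h) := hh.continuous_fderiv one_ne_zero
  obtain ⟨M, hM⟩ := (isCompact_closedBall (0 : E) 2).exists_bound_of_continuousOn
    hcont.continuousOn
  have hM0 : 0 ≤ M := (norm_nonneg _).trans (hM 0 (by simp))
  have hlip : ∀ x ∈ Metric.closedBall (0 : E) 2, ∀ y ∈ Metric.closedBall (0 : E) 2,
      ‖h x - h y‖ ≤ M * ‖x - y‖ := fun x hx y hy =>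
    (convex_closedBall (0 : E) 2).norm_image_sub_le_of_norm_fderiv_le
      (fun z _ => (hhd z).differentiableAt) hM hy hx
  -- Nodes below `1 / (M + 3)` satisfy both smallness conditions `t * M < 1` and `t * 3 < 1`.
  obtain ⟨c, t, ht, hc, hct⟩ := Polynomial.exists_extrapolation_weights (Module.finrank ℝ E)
    (ε := 1 / (M + 3)) (by positivity)
  have hvol : ∀ i, ∫ x in B, (1 + t i • fderiv ℝ h x).det = volume.real B := by
    intro i
    have ht0 := (ht i).1
    have ht1 : t i * (M + 3) < 1 := (lt_div_iff₀ (by positivity)).1 (ht i).2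
    obtain ⟨hinj, him⟩ := image_closedBall_eq_of_small ht0 (by nlinarith) (by nlinarith) hlip
      (fun x => by rw [hfh, hf1]) (fun x hx => by rw [hfh, hs x hx]) hM0
    have hder : ∀ x ∈ B, HasFDerivWithinAt (fun x => x + t i • h x)
        (1 + t i • fderiv ℝ h x) B x := fun x _ =>
      ((hasFDerivAt_id x).add ((hhd x).const_smul (t i))).hasFDerivWithinAt
    have := integral_image_eq_integral_abs_det_fderiv_smul volume
      Metric.isClosed_closedBall.measurableSet hder hinj (fun _ => (1 : ℝ))
    rw [← hB] at him
    rw [him] at this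
    simp only [integral_const, smul_eq_mul, mul_one, measureReal_restrict_apply_univ] at this
    rw [this]
    refine setIntegral_congr_fun Metric.isClosed_closedBall.measurableSet fun x hx => ?_
    refine (abs_of_pos (ContinuousLinearMap.det_one_add_pos ?_)).symm
    rw [norm_smul, Real.norm_of_nonneg ht0.le]
    have := hM x (Metric.closedBall_subset_closedBall (by norm_num) hx)
    nlinarith
  have hpos : 0 < volume.real B :=
    ENNReal.toReal_pos (Metric.measure_closedBall_pos volume 0 one_pos).ne'
      (isCompact_closedBall (0 : E) 1).measure_lt_top.ne
  have hint : ∀ i, IntegrableOn (fun x => (1 + t i • fderiv ℝ h x).det) B := fun i =>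
    (ContinuousLinearMap.continuous_det.comp
      (continuous_const.add (hcont.const_smul (t i)))).continuousOn.integrableOn_compact
      (isCompact_closedBall (0 : E) 1)
  -- Extrapolating pointwise from the small nodes to `1` and integrating afterwards avoids having to
  -- write the integral itself as a polynomial in `t`.
  have hsum : ∀ x, (0 : ℝ) = ∑ i, c i * (1 + t i • fderiv ℝ h x).det := by
    intro x
    obtain ⟨p, hp, hpt⟩ := (fderiv ℝ h x).exists_polynomial_det_one_add_smul
    have h1 := hct p hp
    simp_rw [← hpt] at h1
    rw [← h1, one_smul]
    have h2 : fderiv ℝ h x = fderiv ℝ f x - 1 :=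
      ((hf.differentiable one_ne_zero).differentiableAt.hasFDerivAt.sub
        (hasFDerivAt_id x)).fderiv
    rw [h2, add_sub_cancel, det_fderiv_eq_zero_of_norm_eq_one hf hf1]
  have hz : (0 : ℝ) = volume.real B := by
    calc (0 : ℝ) = ∫ x in B, ∑ i, c i * (1 + t i • fderiv ℝ h x).det := by simp [← hsum]
      _ = ∑ i, c i * ∫ x in B, (1 + t i • fderiv ℝ h x).det := by
        rw [integral_finsetSum _ fun i _ => (hint i).const_mul _]
        simp_rw [integral_const_mul]
      _ = volume.real B := by simp_rw [hvol]; rw [← Finset.sum_mul, hc, one_mul]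
  exact hpos.ne hz

/-- A `C¹` vector field pointing outwards outside of a ball has a zero. -/
theorem exists_zero_of_inner_pos {F : E → E} (hF : ContDiff ℝ 1 F) {R : ℝ} (hR : 0 < R)
    (hpos : ∀ x, R ≤ ‖x‖ → 0 < inner ℝ (F x) x) : ∃ x, F x = 0 := by
  by_contra! hne
  -- `G` is `F` on the ball of radius `R` and the identity outside radius `R + 1`. In between,
  -- `inner (G x) x` is a convex combination of positive numbers, so the blending creates no zero.
  let χ : ContDiffBump (0 : E) := ⟨R, R + 1, hR, by linarith⟩
  let G : E → E := fun x => χ x • F x + (1 - χ x) • x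
  have hχ : ContDiff ℝ 1 χ := χ.contDiff
  have hG : ContDiff ℝ 1 G :=
    (hχ.smul hF).add ((contDiff_const.sub hχ).smul contDiff_id)
  have hG0 : ∀ x, G x ≠ 0 := by
    intro x hx
    rcases le_or_gt ‖x‖ R with h | h
    · have h1 : χ x = 1 := χ.one_of_mem_closedBall (by simpa using h)
      simp only [G, h1, one_smul, sub_self, zero_smul, add_zero] at hx
      exact hne x hx
    · have h1 : inner ℝ (G x) x = χ x * inner ℝ (F x) x + (1 - χ x) * ‖x‖ ^ 2 := by
        simp only [G, inner_add_left, real_inner_smul_left, real_inner_self_eq_norm_sq]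
      rw [hx, inner_zero_left] at h1
      have h2 := hpos x h.le
      have h3 : 0 < ‖x‖ ^ 2 := by have := hR.trans h; positivity
      have h4 : 0 ≤ χ x := χ.nonneg
      have h5 : χ x ≤ 1 := χ.le_one
      rcases h4.eq_or_lt with h6 | h6
      · rw [← h6] at h1; linarith
      · nlinarith [mul_pos h6 h2, mul_nonneg (sub_nonneg.2 h5) h3.le]
  have hGs : ContDiff ℝ 1 fun x : E => G ((R + 1) • x) := hG.comp (contDiff_const_smul (R + 1))
  -- Rescaling by `R + 1` moves the region where `G` is the identity to `1 ≤ ‖x‖`; there the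
  -- normalised field is `x / ‖x‖`.
  refine no_smooth_retraction (f := fun x : E => ‖G ((R + 1) • x)‖⁻¹ • G ((R + 1) • x))
    ((ContDiff.inv (hGs.norm ℝ fun x => hG0 _) fun x => norm_ne_zero_iff.2 (hG0 _)).smul hGs)
    (fun x => ?_) (fun x hx => ?_)
  · rw [norm_smul, norm_inv, norm_norm, inv_mul_cancel₀ (norm_ne_zero_iff.2 (hG0 _))]
  · have hR1 : 0 < R + 1 := by linarith
    have h1 : χ ((R + 1) • x) = 0 := χ.zero_of_le_dist (by
      rw [dist_zero_right, norm_smul, Real.norm_of_nonneg hR1.le]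
      change R + 1 ≤ _
      nlinarith)
    have h2 : G ((R + 1) • x) = (R + 1) • x := by simp [G, h1]
    rw [h2, norm_smul, Real.norm_of_nonneg hR1.le, smul_smul]
    congr 1
    have : ‖x‖ ≠ 0 := by positivity
    field_simp

theorem contDiff_bilinear_diag {G : Type*} [NormedAddCommGroup G] [NormedSpace ℝ G]
    (T : E →ₗ[ℝ] E →ₗ[ℝ] G) {n : WithTop ℕ∞} : ContDiff ℝ n fun x => T x x := by
  let T' : E →L[ℝ] E →L[ℝ] G := LinearMap.toContinuousLinearMap
    ((LinearMap.toContinuousLinearMap : (E →ₗ[ℝ] G) ≃ₗ[ℝ] E →L[ℝ] G).toLinearMap ∘ₗ T)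
  exact T'.contDiff.clm_apply contDiff_id

/-- A quadratic equation whose linear part is coercive and whose quadratic part is orthogonal to
the unknown has a solution in finite dimension. -/
theorem exists_solution_of_coercive (a : E →ₗ[ℝ] E →ₗ[ℝ] ℝ) (b : E →ₗ[ℝ] E →ₗ[ℝ] E →ₗ[ℝ] ℝ)
    (l : E →ₗ[ℝ] ℝ) {α : ℝ} (hα : 0 < α) (ha : ∀ x, α * ‖x‖ ^ 2 ≤ a x x)
    (hb : ∀ x, b x x x = 0) : ∃ x, ∀ y, a x y + b x x y = l y := by
  let e : (E →ₗ[ℝ] ℝ) ≃ₗ[ℝ] E →L[ℝ] ℝ := LinearMap.toContinuousLinearMap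
  let F : E → E := fun x => (InnerProductSpace.toDual ℝ E).symm (e (a x) + e (b x x) - e l)
  have hF : ∀ x y, inner ℝ (F x) y = a x y + b x x y - l y := fun x y =>
    InnerProductSpace.toDual_symm_apply
  have h1 : ContDiff ℝ 1 fun x => e (a x) :=
    (LinearMap.toContinuousLinearMap (e.toLinearMap ∘ₗ a)).contDiff
  have h2 : ContDiff ℝ 1 fun x => e (b x x) :=
    contDiff_bilinear_diag (b.compr₂ e.toLinearMap)
  have hFc : ContDiff ℝ 1 F :=
    (InnerProductSpace.toDual ℝ E).symm.contDiff.comp ((h1.add h2).sub contDiff_const)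
  -- For this `R`, `‖x‖ ≥ R` gives `α ‖x‖² - ‖e l‖ ‖x‖ ≥ ‖x‖ > 0`. The quadratic term drops out by
  -- `hb`.
  obtain ⟨x, hx⟩ := exists_zero_of_inner_pos hFc (R := (‖e l‖ + 1) / α) (by positivity)
    (fun x hx => by
      rw [hF, hb]
      have h3 : l x ≤ ‖e l‖ * ‖x‖ := (le_abs_self _).trans ((e l).le_opNorm x)
      have h4 : ‖e l‖ + 1 ≤ ‖x‖ * α := (div_le_iff₀ hα).1 hx
      have h5 : 0 < ‖x‖ := lt_of_lt_of_le (by positivity) hx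
      nlinarith [ha x])
  refine ⟨x, fun y => ?_⟩
  have := hF x y
  rw [hx, inner_zero_left] at this
  linarith

end NoRetraction

/-! ### Sobolev and Poincaré inequalities; integrability of the convection term -/

namespace ADLROM

section Sobolev

open scoped ENNReal NNReal

variable {d : ℕ} {Ω : Set (Space d)}

/-- The operator norm is at most the Frobenius norm, by Cauchy-Schwarz in each row. -/
theorem norm_fderiv_le_norm_gradField (ψ : Space d → Space d) (x : Space d) :
    ‖fderiv ℝ ψ x‖ ≤ ‖gradField ψ x‖ := by
  refine ContinuousLinearMap.opNorm_le_bound _ (norm_nonneg _) fun v => ?_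
  refine le_of_sq_le_sq ?_ (by positivity)
  have hv : ∀ i, fderiv ℝ ψ x v i = ∑ j, gradField ψ x (i, j) * v j := by
    intro i
    conv_lhs => rw [← (EuclideanSpace.basisFun (Fin d) ℝ).sum_repr v]
    simp [map_sum, gradField, mul_comm]
  rw [mul_pow, EuclideanSpace.real_norm_sq_eq, EuclideanSpace.real_norm_sq_eq,
    EuclideanSpace.real_norm_sq_eq, Fintype.sum_prod_type, Finset.sum_mul]
  refine Finset.sum_le_sum fun i _ => ?_
  rw [hv]
  exact Finset.sum_mul_sq_le_sq_mul_sq _ _ _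

/-- Sobolev and Poincaré inequalities for test fields. -/
theorem exists_eLpNorm_le_gradField (hd : d = 2 ∨ d = 3) (hΩb : Bornology.IsBounded Ω)
    (hΩ : IsOpen Ω) {q : ℝ≥0} (hq : q = 2 ∨ q = 4) :
    ∃ C : ℝ≥0, ∀ ψ : Space d → Space d, IsTestField Ω ψ →
      eLpNorm ψ q (volume.restrict Ω) ≤ C * eLpNorm (gradField ψ) 2 (volume.restrict Ω) := by
  -- The exponent must be below `d`, which excludes `2` when `d = 2`, and must satisfy `1/p - 1/d ≤
  -- 1/q`. For `d = 3`, `q = 4` the value `12/7` gives equality: `7/12 - 1/3 = 1/4`. Since `p ≤ 2`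
  -- and `Ω` has finite measure, Hölder replaces `p` by `2` at the cost of `C₂`.
  let p : ℝ≥0 := 12 / 7
  let C₁ : ℝ≥0 := eLpNormLESNormFDerivOfLeConst (Space d) (volume : Measure (Space d)) Ω p q
  let C₂ : ℝ≥0∞ := (volume.restrict Ω) Set.univ ^ (1 / (p : ℝ≥0∞).toReal - 1 / (2 : ℝ≥0∞).toReal)
  have hexp : (0 : ℝ) ≤ 1 / (p : ℝ≥0∞).toReal - 1 / (2 : ℝ≥0∞).toReal := by
    simp only [ENNReal.coe_toReal, ENNReal.toReal_ofNat]
    norm_num [p]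
  have hC₂ : C₂ ≠ ⊤ := by
    refine ENNReal.rpow_ne_top_of_nonneg hexp ?_
    rw [Measure.restrict_apply_univ]
    exact hΩb.measure_lt_top.ne
  refine ⟨C₁ * C₂.toNNReal, fun ψ hψ => ?_⟩
  obtain ⟨hψ1, hψ2, hψ3⟩ := hψ
  have hfin : Module.finrank ℝ (Space d) = d := by simp
  have hψC : ContDiff ℝ 1 ψ := hψ1.of_le (by exact_mod_cast le_top)
  have hsupp : Function.support ψ ⊆ Ω := (subset_tsupport ψ).trans hψ3
  have hsupp' : Function.support (fun x => ‖fderiv ℝ ψ x‖) ⊆ Ω := fun x hx =>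
    hψ3 (support_fderiv_subset ℝ fun h => hx (by simp [h]))
  have hcont : Continuous (fderiv ℝ ψ) := hψC.continuous_fderiv one_ne_zero
  calc eLpNorm ψ q (volume.restrict Ω) ≤ eLpNorm ψ q volume := eLpNorm_restrict_le _ _ _ _
    _ ≤ C₁ * eLpNorm (fderiv ℝ ψ) p volume := by
      refine eLpNorm_le_eLpNorm_fderiv_of_le volume hψC hsupp ?_ ?_ ?_ hΩb
      · rw [← NNReal.coe_le_coe]; norm_num [p]
      · rw [hfin, ← NNReal.coe_lt_coe]; rcases hd with rfl | rfl <;> norm_num [p]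
      · rw [hfin]; rcases hd with rfl | rfl <;> rcases hq with rfl | rfl <;> norm_num [p]
    _ = C₁ * eLpNorm (fderiv ℝ ψ) p (volume.restrict Ω) := by
      rw [← eLpNorm_norm (fderiv ℝ ψ), ← eLpNorm_norm (fderiv ℝ ψ),
        eLpNorm_restrict_eq_of_support_subset hsupp']
    _ ≤ C₁ * (eLpNorm (fderiv ℝ ψ) 2 (volume.restrict Ω) * C₂) := by
      gcongr
      refine eLpNorm_le_eLpNorm_mul_rpow_measure_univ ?_ hcont.aestronglyMeasurable
      have : p ≤ 2 := by rw [← NNReal.coe_le_coe]; norm_num [p]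
      exact_mod_cast this
    _ ≤ C₁ * (eLpNorm (gradField ψ) 2 (volume.restrict Ω) * C₂) := by
      gcongr
      exact eLpNorm_mono (norm_fderiv_le_norm_gradField ψ)
    _ = (C₁ * C₂.toNNReal : ℝ≥0) * eLpNorm (gradField ψ) 2 (volume.restrict Ω) := by
      rw [ENNReal.coe_mul, ENNReal.coe_toNNReal hC₂]; ring

theorem IsTestField.add {ψ χ : Space d → Space d} (hψ : IsTestField Ω ψ) (hχ : IsTestField Ω χ) :
    IsTestField Ω (ψ + χ) :=
  ⟨hψ.1.add hχ.1, hψ.2.1.add hχ.2.1,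
    (tsupport_add ψ χ).trans (Set.union_subset hψ.2.2 hχ.2.2)⟩

theorem IsTestField.const_smul {ψ : Space d → Space d} (c : ℝ) (hψ : IsTestField Ω ψ) :
    IsTestField Ω (c • ψ) :=
  ⟨contDiff_const.smul hψ.1, hψ.2.1.smul_left (f := fun _ => c),
    (tsupport_smul_subset_right (fun _ => c) ψ).trans hψ.2.2⟩

theorem IsTestField.differentiable {ψ : Space d → Space d} (hψ : IsTestField Ω ψ) :
    Differentiable ℝ ψ := hψ.1.differentiable (by simp)

/-- The elements of the span in the definition of `H10` are test fields. -/
theorem exists_testField_of_mem_span {p : WithLp 2 (L2Vec Ω × L2Mat Ω)}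
    (hp : p ∈ Submodule.span ℝ
      {p : WithLp 2 (L2Vec Ω × L2Mat Ω) | ∃ ψ : Space d → Space d, IsTestField Ω ψ ∧
        p.fst =ᵐ[volume.restrict Ω] ψ ∧ p.snd =ᵐ[volume.restrict Ω] gradField ψ}) :
    ∃ ψ : Space d → Space d, IsTestField Ω ψ ∧
      p.fst =ᵐ[volume.restrict Ω] ψ ∧ p.snd =ᵐ[volume.restrict Ω] gradField ψ := by
  induction hp using Submodule.span_induction with
  | mem p hp => exact hp
  | zero =>
    refine ⟨0, ⟨contDiff_const, HasCompactSupport.zero, by simp⟩, ?_, ?_⟩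
    · exact Lp.coeFn_zero _ _ _
    · refine (Lp.coeFn_zero _ _ _).trans (Filter.Eventually.of_forall fun x => ?_)
      ext ij
      simp [gradField]
  | add p q _ _ hp hq =>
    obtain ⟨ψ, hψ, hp1, hp2⟩ := hp
    obtain ⟨χ, hχ, hq1, hq2⟩ := hq
    refine ⟨ψ + χ, hψ.add hχ, ?_, ?_⟩
    · exact (Lp.coeFn_add _ _).trans (hp1.add hq1)
    · refine (Lp.coeFn_add _ _).trans ((hp2.add hq2).trans
        (Filter.Eventually.of_forall fun x => ?_))
      ext ij
      simp [gradField, fderiv_add (hψ.differentiable x) (hχ.differentiable x)]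
  | smul c p _ hp =>
    obtain ⟨ψ, hψ, hp1, hp2⟩ := hp
    refine ⟨c • ψ, hψ.const_smul c, ?_, ?_⟩
    · exact (Lp.coeFn_smul _ _).trans (hp1.const_smul c)
    · refine (Lp.coeFn_smul _ _).trans ((hp2.const_smul c).trans
        (Filter.Eventually.of_forall fun x => ?_))
      ext ij
      simp [gradField, fderiv_const_smul (hψ.differentiable x) c]

/-- Sobolev and Poincaré inequalities on `H¹₀`. -/
theorem exists_eLpNorm_toL2_le (hd : d = 2 ∨ d = 3) (hΩ : IsOpen Ω)
    (hΩb : Bornology.IsBounded Ω) {q : ℝ≥0} (hq : q = 2 ∨ q = 4) :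
    ∃ C : ℝ≥0, ∀ u : H10 Ω, eLpNorm (toL2 u) q (volume.restrict Ω) ≤ C * ‖grad u‖ₑ := by
  obtain ⟨C, hC⟩ := exists_eLpNorm_le_gradField hd hΩb hΩ hq
  refine ⟨C, fun u => ?_⟩
  obtain ⟨p, hp, hlim⟩ := mem_closure_iff_seq_limit.1 u.2
  have hbound : ∀ n, eLpNorm (p n).fst q (volume.restrict Ω) ≤ C * ‖(p n).snd‖ₑ := by
    intro n
    obtain ⟨ψ, hψ, h1, h2⟩ := exists_testField_of_mem_span (hp n)
    rw [eLpNorm_congr_ae h1, Lp.enorm_def, eLpNorm_congr_ae h2]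
    exact hC ψ hψ
  have h1 : Filter.Tendsto (fun n => (p n).fst) Filter.atTop (nhds (toL2 u)) :=
    ((WithLp.fstL 2 ℝ (L2Vec Ω) (L2Mat Ω)).continuous.tendsto u.1).comp hlim
  have h2 : Filter.Tendsto (fun n => (p n).snd) Filter.atTop (nhds (grad u)) :=
    ((WithLp.sndL 2 ℝ (L2Vec Ω) (L2Mat Ω)).continuous.tendsto u.1).comp hlim
  -- Convergence in `L²` says nothing about `L^q` norms directly; an almost everywhere convergent
  -- subsequence and Fatou's lemma give lower semicontinuity.
  obtain ⟨ns, hns, hae⟩ := (tendstoInMeasure_of_tendsto_Lp h1).exists_seq_tendsto_ae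
  refine (Lp.eLpNorm_lim_le_liminf_eLpNorm (fun n => Lp.aestronglyMeasurable _) _ hae).trans ?_
  have h3 : Filter.Tendsto (fun n => C * ‖(p (ns n)).snd‖ₑ) Filter.atTop
      (nhds (C * ‖grad u‖ₑ)) :=
    ENNReal.Tendsto.const_mul ((h2.comp hns.tendsto_atTop).enorm) (Or.inr ENNReal.coe_ne_top)
  rw [← h3.liminf_eq]
  exact Filter.liminf_le_liminf (Filter.Eventually.of_forall fun n => hbound (ns n))

theorem exists_poincare (hd : d = 2 ∨ d = 3) (hΩ : IsOpen Ω) (hΩb : Bornology.IsBounded Ω) :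
    (poincareConstants Ω).Nonempty := by
  obtain ⟨C, hC⟩ := exists_eLpNorm_toL2_le hd hΩ hΩb (q := 2) (Or.inl rfl)
  refine ⟨C, C.2, fun v => ?_⟩
  have h : ‖toL2 v‖ₑ ≤ C * ‖grad v‖ₑ := by rw [Lp.enorm_def]; exact_mod_cast hC v
  have := ENNReal.toReal_mono (by finiteness) h
  simpa using this

theorem memLp_four_toL2 (hd : d = 2 ∨ d = 3) (hΩ : IsOpen Ω) (hΩb : Bornology.IsBounded Ω)
    (u : H10 Ω) (i : Fin d) : MemLp (fun x => toL2 u x i) 4 (volume.restrict Ω) := by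
  obtain ⟨C, hC⟩ := exists_eLpNorm_toL2_le hd hΩ hΩb (q := 4) (Or.inr rfl)
  have h : MemLp (toL2 u) 4 (volume.restrict Ω) :=
    ⟨Lp.aestronglyMeasurable _, lt_of_le_of_lt (by exact_mod_cast hC u) (by finiteness)⟩
  exact (EuclideanSpace.proj (𝕜 := ℝ) i).comp_memLp' h

/-- Hölder with `1/4 + 1/2 + 1/4 = 1`. Without integrability the Bochner integral takes the default
value `0` and `convection` need not be additive. -/
theorem integrable_convection (hd : d = 2 ∨ d = 3) (hΩ : IsOpen Ω)
    (hΩb : Bornology.IsBounded Ω) (u v w : H10 Ω) :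
    Integrable (fun x => ∑ i : Fin d, ∑ j : Fin d, toL2 u x j * grad v x (i, j) * toL2 w x i)
      (volume.restrict Ω) := by
  refine integrable_finsetSum _ fun i _ => integrable_finsetSum _ fun j _ => ?_
  have hG : MemLp (fun x => grad v x (i, j)) 2 (volume.restrict Ω) :=
    (EuclideanSpace.proj (𝕜 := ℝ) (i, j)).comp_memLp' (Lp.memLp (grad v))
  have _ : ENNReal.HolderTriple 4 4 2 := ⟨by
    rw [show (4 : ℝ≥0∞) = 2 * 2 by norm_num, ENNReal.mul_inv (by simp) (by simp), ← mul_add,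
      ENNReal.inv_two_add_inv_two, mul_one]⟩
  have h := ((memLp_four_toL2 hd hΩ hΩb u j).mul' (r := 2) (memLp_four_toL2 hd hΩ hΩb w i))
  have h2 := memLp_one_iff_integrable.1 (hG.mul' (r := 1) h)
  refine h2.congr (Filter.Eventually.of_forall fun x => ?_)
  ring

end Sobolev

end ADLROM

/-! ### Trilinear forms, one BDF2 step and summation over the steps, in abstract form -/

section Abstract

/-- The convection form on abstract fields with square integrable values and gradients. -/
theorem exists_trilinear_of_integrable {α ι X : Type*} [Fintype ι] [MeasurableSpace α]
    {μ : Measure α} [AddCommMonoid X] [Module ℝ X] (S : X →ₗ[ℝ] Lp (EuclideanSpace ℝ ι) 2 μ)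
    (G : X →ₗ[ℝ] Lp (EuclideanSpace ℝ (ι × ι)) 2 μ)
    (hi : ∀ u v w : X, Integrable (fun x => ∑ i, ∑ j, S u x j * G v x (i, j) * S w x i) μ) :
    ∃ T : X →ₗ[ℝ] X →ₗ[ℝ] X →ₗ[ℝ] ℝ, ∀ u v w,
      T u v w = ∫ x, ∑ i, ∑ j, S u x j * G v x (i, j) * S w x i ∂μ := by
  let c : X → X → X → ℝ := fun u v w => ∫ x, ∑ i, ∑ j, S u x j * G v x (i, j) * S w x i ∂μ
  have ha1 : ∀ u u' v w : X, c (u + u') v w = c u v w + c u' v w := by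
    intro u u' v w
    refine Eq.trans (integral_congr_ae ?_) (integral_add (hi u v w) (hi u' v w))
    filter_upwards [Lp.coeFn_add (S u) (S u')] with x hx
    rw [map_add]
    simp only [hx, ← Finset.sum_add_distrib, Pi.add_apply, PiLp.add_apply]
    refine Finset.sum_congr rfl fun i _ => Finset.sum_congr rfl fun j _ => ?_
    ring
  have hs1 : ∀ (k : ℝ) (u v w : X), c (k • u) v w = k • c u v w := by
    intro k u v w
    refine Eq.trans (integral_congr_ae ?_) (integral_smul k _)
    filter_upwards [Lp.coeFn_smul k (S u)] with x hx
    rw [map_smul]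
    simp only [hx, Pi.smul_apply, PiLp.smul_apply, smul_eq_mul, Finset.mul_sum]
    refine Finset.sum_congr rfl fun i _ => Finset.sum_congr rfl fun j _ => ?_
    ring
  have ha2 : ∀ u v v' w : X, c u (v + v') w = c u v w + c u v' w := by
    intro u v v' w
    refine Eq.trans (integral_congr_ae ?_) (integral_add (hi u v w) (hi u v' w))
    filter_upwards [Lp.coeFn_add (G v) (G v')] with x hx
    rw [map_add]
    simp only [hx, ← Finset.sum_add_distrib, Pi.add_apply, PiLp.add_apply]
    refine Finset.sum_congr rfl fun i _ => Finset.sum_congr rfl fun j _ => ?_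
    ring
  have hs2 : ∀ (k : ℝ) (u v w : X), c u (k • v) w = k • c u v w := by
    intro k u v w
    refine Eq.trans (integral_congr_ae ?_) (integral_smul k _)
    filter_upwards [Lp.coeFn_smul k (G v)] with x hx
    rw [map_smul]
    simp only [hx, Pi.smul_apply, PiLp.smul_apply, smul_eq_mul, Finset.mul_sum]
    refine Finset.sum_congr rfl fun i _ => Finset.sum_congr rfl fun j _ => ?_
    ring
  have ha3 : ∀ u v w w' : X, c u v (w + w') = c u v w + c u v w' := by
    intro u v w w'
    refine Eq.trans (integral_congr_ae ?_) (integral_add (hi u v w) (hi u v w'))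
    filter_upwards [Lp.coeFn_add (S w) (S w')] with x hx
    rw [map_add]
    simp only [hx, ← Finset.sum_add_distrib, Pi.add_apply, PiLp.add_apply]
    refine Finset.sum_congr rfl fun i _ => Finset.sum_congr rfl fun j _ => ?_
    ring
  have hs3 : ∀ (k : ℝ) (u v w : X), c u v (k • w) = k • c u v w := by
    intro k u v w
    refine Eq.trans (integral_congr_ae ?_) (integral_smul k _)
    filter_upwards [Lp.coeFn_smul k (S w)] with x hx
    rw [map_smul]
    simp only [hx, Pi.smul_apply, PiLp.smul_apply, smul_eq_mul, Finset.mul_sum]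
    refine Finset.sum_congr rfl fun i _ => Finset.sum_congr rfl fun j _ => ?_
    ring
  exact ⟨{  toFun := fun u => LinearMap.mk₂ ℝ (c u) (ha2 u) (fun k => hs2 k u) (ha3 u)
              (fun k => hs3 k u)
            map_add' := fun u u' => by ext v w; exact ha1 u u' v w
            map_smul' := fun k u => by ext v w; exact hs1 k u v w }, fun _ _ _ => rfl⟩

theorem exists_trilinear_skew_part {X : Type*} [AddCommMonoid X] [Module ℝ X]
    {c : X → X → X → ℝ} (hc : ∃ T : X →ₗ[ℝ] X →ₗ[ℝ] X →ₗ[ℝ] ℝ, ∀ u v w, T u v w = c u v w) :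
    ∃ T : X →ₗ[ℝ] X →ₗ[ℝ] X →ₗ[ℝ] ℝ, ∀ u v w, T u v w = (1 / 2) * (c u v w - c u w v) := by
  obtain ⟨T, hT⟩ := hc
  simp_rw [← hT]
  exact ⟨{  toFun := fun x => (1 / 2 : ℝ) • (T x - (T x).flip)
            map_add' := fun x y => by ext; simp; ring
            map_smul' := fun c x => by ext; simp; ring }, fun _ _ _ => rfl⟩

theorem exists_trilinear_restrict {X : Type*} [AddCommMonoid X] [Module ℝ X]
    {c : X → X → X → ℝ} (hc : ∃ T : X →ₗ[ℝ] X →ₗ[ℝ] X →ₗ[ℝ] ℝ, ∀ u v w, T u v w = c u v w)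
    (W : Submodule ℝ X) :
    ∃ T : W →ₗ[ℝ] W →ₗ[ℝ] W →ₗ[ℝ] ℝ, ∀ u v w : W, T u v w = c u v w := by
  obtain ⟨T, hT⟩ := hc
  simp_rw [← hT]
  exact ⟨{  toFun := fun x => (T x).compl₁₂ W.subtype W.subtype
            map_add' := fun x y => by ext; simp
            map_smul' := fun c x => by ext; simp }, fun _ _ _ => rfl⟩

/-- Solvability of an implicit BDF2 step with a skew-symmetric quadratic term, in a finite
dimensional space. -/
theorem exists_bdf2_step {V H₁ H₂ : Type*} [AddCommGroup V] [Module ℝ V] [FiniteDimensional ℝ V]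
    [NormedAddCommGroup H₁] [InnerProductSpace ℝ H₁] [NormedAddCommGroup H₂]
    [InnerProductSpace ℝ H₂] (S : V →ₗ[ℝ] H₁) (G : V →ₗ[ℝ] H₂) (hS : Function.Injective S)
    {c : V → V → V → ℝ} (hc : ∃ T : V →ₗ[ℝ] V →ₗ[ℝ] V →ₗ[ℝ] ℝ, ∀ u v w, T u v w = c u v w)
    (hc0 : ∀ w v, c w v v = 0) (D : V →ₗ[ℝ] V) {ν Δt : ℝ}
    (hν : 0 < ν) (hΔt : 0 < Δt) (f : H₁) (uold u : V) :
    ∃ unew : V, ∀ v : V,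
      inner ℝ (S ((3 : ℝ) • unew - (4 : ℝ) • u + uold)) (S v) / (2 * Δt)
        + ν * inner ℝ (G unew) (G v) + c (D unew) unew v = inner ℝ f (S v) := by
  obtain ⟨T, hT⟩ := hc
  simp_rw [← hT] at hc0 ⊢
  -- `V` carries no norm. Its image under the injective `S` inherits the inner product of `H₁`,
  -- which makes it a Euclidean space.
  let e : V ≃ₗ[ℝ] LinearMap.range S := LinearEquiv.ofInjective S hS
  let U : LinearMap.range S →ₗ[ℝ] V := e.symm.toLinearMap
  have heS : ∀ x, S (U x) = x := fun x => congrArg Subtype.val (e.apply_symm_apply x)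
  let a : LinearMap.range S →ₗ[ℝ] LinearMap.range S →ₗ[ℝ] ℝ :=
    (3 / (2 * Δt)) • (innerₗ H₁).compl₁₂ (S ∘ₗ U) (S ∘ₗ U)
      + ν • (innerₗ H₂).compl₁₂ (G ∘ₗ U) (G ∘ₗ U)
  let b : LinearMap.range S →ₗ[ℝ] LinearMap.range S →ₗ[ℝ] LinearMap.range S →ₗ[ℝ] ℝ :=
    { toFun := fun x => (T (D (U x))).compl₁₂ U U
      map_add' := fun x y => by ext; simp
      map_smul' := fun c x => by ext; simp }
  let l : LinearMap.range S →ₗ[ℝ] ℝ :=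
    innerₗ H₁ (f + (1 / (2 * Δt)) • S ((4 : ℝ) • u - uold)) ∘ₗ S ∘ₗ U
  have ha : ∀ x y, a x y = 3 / (2 * Δt) * inner ℝ (S (U x)) (S (U y))
    + ν * inner ℝ (G (U x)) (G (U y)) := fun x y => rfl
  have hb : ∀ x y, b x x y = T (D (U x)) (U x) (U y) := fun x y => rfl
  -- The term `3 unew / (2Δt)` alone is coercive in the `H₁` norm; the viscous term only has to be
  -- nonnegative.
  obtain ⟨x, hx⟩ := exists_solution_of_coercive a b l (α := 3 / (2 * Δt)) (by positivity)
    (fun x => by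
      rw [ha, heS x, real_inner_self_eq_norm_sq, real_inner_self_eq_norm_sq]
      have h3 : 0 ≤ ν * ‖G (U x)‖ ^ 2 := by positivity
      exact le_add_of_nonneg_right h3)
    (fun x => by rw [hb, hc0])
  refine ⟨U x, fun v => ?_⟩
  have h := hx (e v)
  have hU : U (e v) = v := e.symm_apply_apply v
  have hl : l (e v) = inner ℝ (f + (1 / (2 * Δt)) • S ((4 : ℝ) • u - uold)) (S (U (e v))) := rfl
  rw [ha, hb, hl, hU] at h
  simp only [map_add, map_sub, map_smul, inner_add_left, inner_sub_left,
    real_inner_smul_left] at h ⊢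
  have h5 : Δt ≠ 0 := hΔt.ne'
  field_simp at h ⊢
  linarith

/-- The G-stability of BDF2: the last square is numerical dissipation and the other four form a
telescoping difference. -/
theorem bdf2_identity {H : Type*} [NormedAddCommGroup H] [InnerProductSpace ℝ H] (a b c : H) :
    2 * inner ℝ ((3 : ℝ) • a - (4 : ℝ) • b + c) a
      = ‖a‖ ^ 2 + ‖(2 : ℝ) • a - b‖ ^ 2 - ‖b‖ ^ 2 - ‖(2 : ℝ) • b - c‖ ^ 2
        + ‖a - (2 : ℝ) • b + c‖ ^ 2 := by
  simp only [← real_inner_self_eq_norm_sq, inner_add_left, inner_sub_left, inner_add_right,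
    inner_sub_right, real_inner_smul_left, real_inner_smul_right]
  rw [real_inner_comm a b, real_inner_comm a c, real_inner_comm b c]
  ring

/-- The energy inequality of a single BDF2 step. -/
theorem bdf2_step_energy_le {V H₁ H₂ : Type*} [AddCommGroup V] [Module ℝ V]
    [NormedAddCommGroup H₁] [InnerProductSpace ℝ H₁] [NormedAddCommGroup H₂]
    [InnerProductSpace ℝ H₂] (S : V →ₗ[ℝ] H₁) (G : V →ₗ[ℝ] H₂) {ν Δt m : ℝ} (hν : 0 < ν)
    (hΔt : 0 < Δt) {f : H₁} {uold u unew : V} (hm : |inner ℝ f (S unew)| ≤ m * ‖G unew‖)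
    (h : inner ℝ (S ((3 : ℝ) • unew - (4 : ℝ) • u + uold)) (S unew) / (2 * Δt)
        + ν * inner ℝ (G unew) (G unew) = inner ℝ f (S unew)) :
    ‖S unew‖ ^ 2 + ‖S ((2 : ℝ) • unew - u)‖ ^ 2 + 2 * ν * Δt * ‖G unew‖ ^ 2
      ≤ ‖S u‖ ^ 2 + ‖S ((2 : ℝ) • u - uold)‖ ^ 2 + 2 * ν⁻¹ * Δt * m ^ 2 := by
  have h2 := (le_abs_self _).trans hm
  have h3 := bdf2_identity (S unew) (S u) (S uold)
  rw [real_inner_self_eq_norm_sq] at h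
  simp only [map_add, map_sub, map_smul] at h ⊢
  set I : ℝ := inner ℝ ((3 : ℝ) • S unew - (4 : ℝ) • S u + S uold) (S unew)
  set g := ‖G unew‖
  -- Young's inequality weighted to leave half of the viscous term; multiplication by `4 * Δt` then
  -- produces the stated constants.
  have h7 : m * g ≤ ν / 2 * g ^ 2 + ν⁻¹ / 2 * m ^ 2 := by
    have h8 : 0 ≤ ν⁻¹ / 2 * (ν * g - m) ^ 2 := by positivity
    have h9 : ν⁻¹ / 2 * (ν * g - m) ^ 2 = ν / 2 * g ^ 2 + ν⁻¹ / 2 * m ^ 2 - m * g := by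
      field_simp
      ring
    linarith
  have h10 : I / (2 * Δt) ≤ ν⁻¹ / 2 * m ^ 2 - ν / 2 * g ^ 2 := by linarith
  rw [div_le_iff₀ (by positivity)] at h10
  nlinarith [sq_nonneg ‖S unew - (2 : ℝ) • S u + S uold‖]

theorem le_add_sum_of_step_le {x y g m : ℕ → ℝ} {α β : ℝ} (n : ℕ)
    (h : ∀ k ∈ Finset.Icc 1 n,
      x (k + 1) + y (k + 1) + α * g (k + 1) ≤ x k + y k + β * m k) :
    x (n + 1) + y (n + 1) + α * ∑ k ∈ Finset.Icc 1 n, g (k + 1)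
      ≤ x 1 + y 1 + β * ∑ k ∈ Finset.Icc 1 n, m k := by
  induction n with
  | zero => simp
  | succ n ih =>
    have h1 := ih fun k hk => h k (Finset.Icc_subset_Icc_right n.le_succ hk)
    have h2 := h (n + 1) (by simp)
    rw [Finset.sum_Icc_succ_top (by lia), Finset.sum_Icc_succ_top (by lia), mul_add, mul_add]
    linarith

/-- The final `y K` is nonnegative and is dropped. For `K = 1` the sums are empty. -/
theorem le_add_sum_of_step_le_of_one_le {x y g m : ℕ → ℝ} {α β x₁ y₁ : ℝ} {K : ℕ} (hK : 1 ≤ K)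
    (hy : ∀ k, 0 ≤ y k) (hx1 : x 1 = x₁) (hy1 : y 1 = y₁)
    (h : ∀ k ∈ Finset.Icc 1 (K - 1),
      x (k + 1) + y (k + 1) + α * g (k + 1) ≤ x k + y k + β * m k) :
    x K + α * ∑ k ∈ Finset.Icc 1 (K - 1), g (k + 1)
      ≤ x₁ + y₁ + β * ∑ k ∈ Finset.Icc 1 (K - 1), m k := by
  obtain ⟨n, rfl⟩ : ∃ n, K = n + 1 := ⟨K - 1, by lia⟩
  rw [Nat.add_sub_cancel] at h ⊢
  have := le_add_sum_of_step_le n h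
  linarith [hy (n + 1)]

theorem exists_two_step_recursion {V : Type*} {P : ℕ → V → V → V → Prop}
    (h : ∀ k a b, ∃ c, P k a b c) (a b : V) :
    ∃ u : ℕ → V, u 0 = a ∧ u 1 = b ∧ ∀ k, 1 ≤ k → P k (u (k - 1)) (u k) (u (k + 1)) := by
  choose s hs using h
  -- The state is the pair of consecutive values `(u n, u (n + 1))`; the transition out of state `n`
  -- is step `n + 1`.
  let p : ℕ → V × V := fun n => Nat.rec (a, b) (fun n q => (q.2, s (n + 1) q.1 q.2)) n
  refine ⟨fun n => (p n).1, rfl, rfl, fun k hk => ?_⟩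
  obtain ⟨n, rfl⟩ : ∃ n, k = n + 1 := ⟨k - 1, by lia⟩
  exact hs (n + 1) (p n).1 (p n).2

end Abstract

/-! ### The scheme: solvability, dual norm and energy estimate -/

namespace ADLROM

section Scheme

variable {d : ℕ} {Ω : Set (Space d)}

theorem exists_trilinear_bStar (hd : d = 2 ∨ d = 3) (hΩ : IsOpen Ω)
    (hΩb : Bornology.IsBounded Ω) :
    ∃ T : H10 Ω →ₗ[ℝ] H10 Ω →ₗ[ℝ] H10 Ω →ₗ[ℝ] ℝ, ∀ u v w, T u v w = bStar u v w :=
  exists_trilinear_skew_part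
    (exists_trilinear_of_integrable toL2 grad (integrable_convection hd hΩ hΩb))

theorem bStar_self (u v : H10 Ω) : bStar u v v = 0 := by rw [bStar, sub_self, mul_zero]

/-- Every time step of the scheme can be carried out. -/
theorem exists_isADLStep (hd : d = 2 ∨ d = 3) (hΩ : IsOpen Ω) (hΩb : Bornology.IsBounded Ω)
    {r : ℕ} (φ : Fin r → H10 Ω) {ν Δt : ℝ} (hν : 0 < ν) (hΔt : 0 < Δt) (δ : ℝ) (N : ℕ)
    (f : L2Vec Ω) (uold u : romSpace φ) :
    ∃ unew : romSpace φ, IsADLStep φ ν Δt δ N f uold u unew :=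
  exists_bdf2_step (toL2.comp (romSpace φ).subtype) (grad.comp (romSpace φ).subtype)
    ((toL2_injective hΩ).comp Subtype.val_injective)
    (exists_trilinear_restrict (exists_trilinear_bStar hd hΩ hΩb) (romSpace φ))
    (fun w v => bStar_self w.1 v.1) ((romDeconv φ δ N).comp (romFilterEnd φ δ)) hν hΔt f uold u

/-- The dual norm is attained. -/
theorem abs_inner_le_dualNorm (hP : (poincareConstants Ω).Nonempty) (f : L2Vec Ω) (v : H10 Ω) :
    |inner ℝ f (toL2 v)| ≤ dualNorm f * ‖grad v‖ := by
  obtain ⟨C, hC0, hC⟩ := hP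
  -- If the gradient vanishes there is no quotient to compare with, but Poincaré forces the pairing
  -- to vanish. Otherwise `|(f, v)| / ‖∇v‖` is a lower bound of the set defining `dualNorm f`.
  rcases (norm_nonneg (grad v)).eq_or_lt with h | h
  · have h1 := (abs_real_inner_le_norm f (toL2 v)).trans
      (mul_le_mul_of_nonneg_left (hC v) (norm_nonneg f))
    rw [← h] at h1 ⊢
    simpa using h1
  · rw [← div_le_iff₀ h]
    refine le_csInf ⟨‖f‖ * C, by positivity, fun w => ?_⟩ fun c hc => ?_
    · rw [mul_assoc]
      exact (abs_real_inner_le_norm f (toL2 w)).trans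
        (mul_le_mul_of_nonneg_left (hC w) (norm_nonneg f))
    · rw [div_le_iff₀ h]
      exact hc.2 v

theorem dualNorm_nonneg (f : L2Vec Ω) : 0 ≤ dualNorm f :=
  Real.sInf_nonneg fun _ hc => hc.1

theorem dualNorm_le {C : ℝ} (hC : C ∈ poincareConstants Ω) (f : L2Vec Ω) :
    dualNorm f ≤ C * ‖f‖ := by
  refine csInf_le ⟨0, fun c hc => hc.1⟩ ⟨mul_nonneg hC.1 (norm_nonneg f), fun v => ?_⟩
  refine (abs_real_inner_le_norm f (toL2 v)).trans ?_
  rw [mul_comm C, mul_assoc]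
  exact mul_le_mul_of_nonneg_left (hC.2 v) (norm_nonneg f)

/-- There is a smallest Poincaré constant. -/
theorem exists_isLeast_poincareConstants (hP : (poincareConstants Ω).Nonempty) :
    ∃ C, IsLeast (poincareConstants Ω) C := by
  have hcl : IsClosed (poincareConstants Ω) := by
    have : poincareConstants Ω
        = Set.Ici 0 ∩ ⋂ v : H10 Ω, {c : ℝ | ‖toL2 v‖ ≤ c * ‖grad v‖} := by
      ext c; simp [poincareConstants]
    rw [this]
    exact isClosed_Ici.inter (isClosed_iInter fun v =>
      isClosed_le continuous_const (continuous_id.mul continuous_const))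
  exact ⟨_, hcl.isLeast_csInf hP ⟨0, fun c hc => hc.1⟩⟩

/-- The energy inequality of a time step of the scheme. -/
theorem IsADLStep.energy_le (hP : (poincareConstants Ω).Nonempty) {r : ℕ} {φ : Fin r → H10 Ω}
    {ν Δt δ : ℝ} (hν : 0 < ν) (hΔt : 0 < Δt) {N : ℕ} {f : L2Vec Ω}
    {uold u unew : romSpace φ} (h : IsADLStep φ ν Δt δ N f uold u unew) :
    ‖toL2 unew.1‖ ^ 2 + ‖toL2 ((2 : ℝ) • unew - u : romSpace φ).1‖ ^ 2
        + 2 * ν * Δt * ‖grad unew.1‖ ^ 2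
      ≤ ‖toL2 u.1‖ ^ 2 + ‖toL2 ((2 : ℝ) • u - uold : romSpace φ).1‖ ^ 2
        + 2 * ν⁻¹ * Δt * dualNorm f ^ 2 := by
  -- Testing with `v = unew` makes the convection term vanish, whatever the filtered velocity is.
  have h1 := (congrArg (_ + ·) (bStar_self _ unew.1)).symm.trans (h unew)
  exact bdf2_step_energy_le (toL2.comp (romSpace φ).subtype) (grad.comp (romSpace φ).subtype)
    hν hΔt (abs_inner_le_dualNorm hP f unew.1) ((add_zero _).symm.trans h1)

theorem exists_isADLSolution (hd : d = 2 ∨ d = 3) (hΩ : IsOpen Ω) (hΩb : Bornology.IsBounded Ω)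
    {r : ℕ} (φ : Fin r → H10 Ω) {ν Δt : ℝ} (hν : 0 < ν) (hΔt : 0 < Δt) (δ : ℝ) (N K : ℕ)
    (f : ℝ → L2Vec Ω) (u₀ u₁ : romSpace φ) :
    ∃ u : ℕ → romSpace φ, IsADLSolution φ ν Δt δ N K f u₀ u₁ u :=
  (exists_two_step_recursion (P := fun k => IsADLStep φ ν Δt δ N (f (((k : ℝ) + 1) * Δt)))
    (fun k => exists_isADLStep hd hΩ hΩb φ hν hΔt δ N (f (((k : ℝ) + 1) * Δt))) u₀ u₁).imp
    fun _ hu => ⟨hu.1, hu.2.1, fun k hk => hu.2.2 k (Finset.mem_Icc.1 hk).1⟩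

/-- The a priori bound for runs of the scheme. -/
theorem IsADLSolution.energy_le (hP : (poincareConstants Ω).Nonempty) {r : ℕ} {φ : Fin r → H10 Ω}
    {ν Δt δ : ℝ} (hν : 0 < ν) (hΔt : 0 < Δt) {N K : ℕ} (hK : 1 ≤ K) {f : ℝ → L2Vec Ω}
    {u₀ u₁ : romSpace φ} {u : ℕ → romSpace φ} (hu : IsADLSolution φ ν Δt δ N K f u₀ u₁ u) :
    ‖toL2 (u K).1‖ ^ 2 + 2 * ν * Δt * ∑ κ ∈ Finset.Icc 1 (K - 1), ‖grad (u (κ + 1)).1‖ ^ 2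
      ≤ ‖toL2 u₁.1‖ ^ 2 + ‖toL2 ((2 : ℝ) • u₁ - u₀ : romSpace φ).1‖ ^ 2
        + 2 * ν⁻¹ * Δt * ∑ κ ∈ Finset.Icc 1 (K - 1), dualNorm (f (((κ : ℝ) + 1) * Δt)) ^ 2 :=
  le_add_sum_of_step_le_of_one_le (x := fun k => ‖toL2 (u k).1‖ ^ 2)
    -- The truncated `k - 1` at `k = 0` is harmless: the step inequalities involve `y` only from
    -- index `1` on.
    (y := fun k => ‖toL2 ((2 : ℝ) • u k - u (k - 1) : romSpace φ).1‖ ^ 2)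
    (g := fun k => ‖grad (u k).1‖ ^ 2) (m := fun k => dualNorm (f (((k : ℝ) + 1) * Δt)) ^ 2)
    hK (fun _ => sq_nonneg _) (congrArg (fun a : romSpace φ => ‖toL2 a.1‖ ^ 2) hu.2.1)
    (congrArg₂ (fun a b : romSpace φ => ‖toL2 ((2 : ℝ) • b - a : romSpace φ).1‖ ^ 2) hu.1 hu.2.1)
    (fun k hk => (hu.2.2 k hk).energy_le hP hν hΔt)

theorem sum_dualNorm_sq_le {C : ℝ} (hC : C ∈ poincareConstants Ω) {α β : ℝ} (hβ : 0 ≤ β)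
    (s : Finset ℕ) (f : ℕ → L2Vec Ω) :
    α + β * ∑ κ ∈ s, dualNorm (f κ) ^ 2 ≤ α + β * ∑ κ ∈ s, (C ^ 2 * ‖f κ‖ ^ 2) := by
  gcongr with k
  rw [← mul_pow]
  exact pow_le_pow_left₀ (dualNorm_nonneg _) (dualNorm_le hC _) 2

end Scheme

end ADLROM

theorem lemma4p1 (d : ℕ) (hd : d = 2 ∨ d = 3) (Ω : Set (Space d)) (hΩ : IsOpen Ω)
    (hΩb : Bornology.IsBounded Ω) :
    ∃ CΩ : ℝ, IsLeast (poincareConstants Ω) CΩ ∧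
      ∀ (r : ℕ) (φ : Fin r → H10 Ω), Orthonormal ℝ (fun i => toL2 (φ i)) →
      ∀ (ν Δt δ : ℝ), 0 < ν → 0 < Δt → 0 < δ →
      ∀ (N K : ℕ), 1 ≤ K → ∀ (f : ℝ → L2Vec Ω),
        -- every time step can be carried out, whatever the two previous values are
        (∀ k ∈ Finset.Icc 1 (K - 1), ∀ uold u : romSpace φ, ∃ unew : romSpace φ,
          IsADLStep φ ν Δt δ N (f (((k : ℝ) + 1) * Δt)) uold u unew) ∧
        -- the scheme has a run, and every run satisfies the a priori bound
        ∀ u₀ u₁ : romSpace φ,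
          (∃ u : ℕ → romSpace φ, IsADLSolution φ ν Δt δ N K f u₀ u₁ u) ∧
          ∀ u : ℕ → romSpace φ, IsADLSolution φ ν Δt δ N K f u₀ u₁ u →
            ‖toL2 (u K).1‖ ^ 2
                + 2 * ν * Δt * ∑ κ ∈ Finset.Icc 1 (K - 1), ‖grad (u (κ + 1)).1‖ ^ 2
              ≤ ‖toL2 u₁.1‖ ^ 2 + ‖toL2 ((2 : ℝ) • u₁ - u₀).1‖ ^ 2
                + 2 * ν⁻¹ * Δt * ∑ κ ∈ Finset.Icc 1 (K - 1),
                    dualNorm (f (((κ : ℝ) + 1) * Δt)) ^ 2 ∧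
            ‖toL2 u₁.1‖ ^ 2 + ‖toL2 ((2 : ℝ) • u₁ - u₀).1‖ ^ 2
                + 2 * ν⁻¹ * Δt * ∑ κ ∈ Finset.Icc 1 (K - 1),
                    dualNorm (f (((κ : ℝ) + 1) * Δt)) ^ 2
              ≤ ‖toL2 u₁.1‖ ^ 2 + ‖toL2 ((2 : ℝ) • u₁ - u₀).1‖ ^ 2
                + 2 * ν⁻¹ * Δt * ∑ κ ∈ Finset.Icc 1 (K - 1),
                    (CΩ ^ 2 * ‖f (((κ : ℝ) + 1) * Δt)‖ ^ 2) := by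
  have hP := exists_poincare hd hΩ hΩb
  refine (exists_isLeast_poincareConstants hP).elim fun C hC => ⟨C, hC, ?_⟩
  intro r φ _ ν Δt δ hν hΔt _ N K hK f
  refine ⟨fun k _ uold u => exists_isADLStep hd hΩ hΩb φ hν hΔt δ N _ uold u, ?_⟩
  intro u₀ u₁
  refine ⟨exists_isADLSolution hd hΩ hΩb φ hν hΔt δ N K f u₀ u₁, ?_⟩
  intro u hu
  exact ⟨hu.energy_le hP hν hΔt hK,
    sum_dualNorm_sq_le hC.1 (by positivity) _ fun κ => f (((κ : ℝ) + 1) * Δt)⟩
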